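/- Let $K$ be a field and let $q\ge 2$. A subalgebra of $M_n(K)$ (always unital) is called $D_q$ if it satisfies the identity $[x_1,y_1][x_2,y_2]\cdots[x_q,y_q]=0$, where $[x,y]=xy-yx$; by convention, a subalgebra is called a $D_q$ subalgebra only if, in addition, it does not satisfy the corresponding identity with $q-1$ factors. Let $n_1,\ldots,n_q$ be positive integers with $n_1+\cdots+n_q=n$. A $D_q$ subalgebra of $M_n(K)$ of type $(n_1,\ldots,n_q)$ with max-dim diagonal blocks is a subalgebra consisting of all block upper triangular matrices $(A_{ij})_{1\le i,j\le q}$, $A_{ij}\in M_{n_i\times n_j}(K)$, such that $A_{ii}\in\mathcal A_{ii}$ for all $i$, $A_{ij}$ is arbitrary for $i<j$, and $A_{ij}=0$ for $i>j$, where each $\mathcal A_{ii}$ is a commutative subalgebra of $M_{n_i}(K)$ whose dimension is maximum among the commutative subalgebras of $M_{n_i}(K)$. Let $\mathcal A$ be a $D_q$ subalgebra of $M_n(K)$ of type $(n_1,\ldots,n_q)$ with max-dim diagonal blocks, and write $n=q\lfloor n/q\rfloor+r$ with $0\le r<q$. Then $\mathcal A$ has the maximum dimension among all $D_q$ subalgebras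 of $M_n(K)$ if and only if there is a permutation $\sigma\in S_q$ such that $n_{\sigma(i)}\le n_{\sigma(j)}$ for all $i<j$ and one of the following holds: (a) $\lfloor n/q\rfloor$ is even and there is an integer $s$ with $0\le s\le\lfloor r/2\rfloor$ such that $$n_{\sigma(i)}=\begin{cases}\lfloor n/q\rfloor, & 1\le i\le q-r+s,\\ \lfloor n/q\rfloor+1, & q-r+s<i\le q-s,\\ \lfloor n/q\rfloor+2, & q-s<i\le q;\end{cases}$$ (b) $\lfloor n/q\rfloor$ is odd and there is an integer $t$ with $0\le t\le\lfloor (q-r)/2\rfloor$ such that $$n_{\sigma(i)}=\begin{cases}\lfloor n/q\rfloor-1, & 1\le i\le t,\\ \lfloor n/q\rfloor, & t<i\le q-r-t,\\ \lfloor n/q\rfloor+1, & q-r-t<i\le q.\end{cases}$$ -/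

import Mathlib

namespace DqAlg

/-- The subalgebra `A` satisfies the identity `[x₁, y₁][x₂, y₂] ⋯ [x_q, y_q] = 0`. -/
def SatisfiesDq {K R : Type*} [CommSemiring K] [Ring R] [Algebra K R]
    (q : ℕ) (A : Subalgebra K R) : Prop :=
  ∀ x y : Fin q → R, (∀ i, x i ∈ A) → (∀ i, y i ∈ A) →
    (List.ofFn fun i => x i * y i - y i * x i).prod = 0

/-- `A` is a `D_q` subalgebra, with the convention that a `D_q` subalgebra is not `D_{q-1}`.
(Used for `2 ≤ q` only.) -/
def IsDqSubalgebra {K R : Type*} [CommSemiring K] [Ring R] [Algebra K R]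
    (q : ℕ) (A : Subalgebra K R) : Prop :=
  SatisfiesDq q A ∧ ¬ SatisfiesDq (q - 1) A

/-- `A` is a commutative subalgebra. -/
def IsCommSubalgebra {K R : Type*} [CommSemiring K] [Ring R] [Algebra K R]
    (A : Subalgebra K R) : Prop :=
  ∀ x ∈ A, ∀ y ∈ A, x * y = y * x

/-- `A` belongs to the class `P` of subalgebras of a finite dimensional algebra `R`, and has
the maximum dimension among all the subalgebras of `R` in the class `P`. -/
def HasMaxDim {K R : Type*} [Field K] [Ring R] [Algebra K R] [FiniteDimensional K R]
    (P : Subalgebra K R → Prop) (A : Subalgebra K R) : Prop :=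
  P A ∧ ∀ B : Subalgebra K R, P B → Module.finrank K B ≤ Module.finrank K A

/-- The `q` consecutive intervals of lengths `d 0, d 1, …, d (q-1)` into which `{0, …, n-1}` is
divided: `⟨i, a⟩` is sent to `d 0 + ⋯ + d (i-1) + a`. -/
def blockIndex {n q : ℕ} (d : Fin q → ℕ) (h : ∑ i, d i = n) :
    ((i : Fin q) × Fin (d i)) ≃ Fin n :=
  finSigmaFinEquiv.trans (finCongr h)

/-- The block in position `(i, j)` of the `n × n` matrix `M`. -/
def block {K : Type*} {n q : ℕ} (d : Fin q → ℕ) (h : ∑ i, d i = n)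
    (M : Matrix (Fin n) (Fin n) K) (i j : Fin q) : Matrix (Fin (d i)) (Fin (d j)) K :=
  M.submatrix (fun a => blockIndex d h ⟨i, a⟩) (fun b => blockIndex d h ⟨j, b⟩)

/-- `A` is the block triangular subalgebra of `M_n(K)` of type `(d 0, …, d (q-1))` with the
subalgebras `D i` of `M_{d i}(K)` as diagonal blocks: it consists of all the matrices whose
`(i, i)` blocks lie in `D i`, whose `(i, j)` blocks with `i < j` are arbitrary, and whose other
blocks are zero. -/
structure IsOfType {K : Type*} [Field K] {n q : ℕ} (d : Fin q → ℕ)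
    (D : (i : Fin q) → Subalgebra K (Matrix (Fin (d i)) (Fin (d i)) K))
    (A : Subalgebra K (Matrix (Fin n) (Fin n) K)) : Prop where
  two_le : 2 ≤ q
  pos : ∀ i, 0 < d i
  sum_eq : ∑ i, d i = n
  mem_iff : ∀ M : Matrix (Fin n) (Fin n) K, M ∈ A ↔
    (∀ i, block d sum_eq M i i ∈ D i) ∧ ∀ i j, j < i → block d sum_eq M i j = 0

/-- `A` is a `D_q` subalgebra of `M_n(K)` of type `(d 0, …, d (q-1))` with max-dim diagonal
blocks: each diagonal block is a commutative subalgebra of `M_{d i}(K)` of maximum dimension. -/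
def IsOfTypeWithMaxDimBlocks {K : Type*} [Field K] {n q : ℕ} (d : Fin q → ℕ)
    (A : Subalgebra K (Matrix (Fin n) (Fin n) K)) : Prop :=
  ∃ D : (i : Fin q) → Subalgebra K (Matrix (Fin (d i)) (Fin (d i)) K),
    IsOfType d D A ∧ ∀ i, HasMaxDim IsCommSubalgebra (D i)

end DqAlg

/-! The function g(m) = m² - 2⌊m²/4⌋ is convex on the natural numbers, and for each k the line of
slope 2k + 1 supporting its graph touches it exactly at m = 2k, 2k + 1, 2k + 2 (`tangent_le`,
`tangent_eq_iff`). By Schur's theorem a maximal commutative block of size m has dimension ⌊m²/4⌋ +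
1, so an algebra of type (d_i) with such blocks satisfies 2 dim = n² + 2q - ∑ g(d_i). Summing the
tangent inequalities bounds this by a quantity depending only on n, q, k, with equality exactly when
all d_i lie in {2k, 2k + 1, 2k + 2}.

The same bound holds for every algebra B satisfying the identity, with no need to triangularise it
(`SatisfiesDq.two_mul_finrank_le`). Let U be the common kernel of the commutators: B acts
commutatively on U, its action on V ⧸ U satisfies the identity with one factor fewer, and what both
actions kill embeds into Hom(V ⧸ U, U); induct on q.

For k = ⌊⌊n/q⌋/2⌋ the balanced sizes attain the bound, so maximality means equality
(`IsOfType.hasMaxDim_iff`). Sorting the sizes and counting those below each threshold then gives the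
explicit lists (`forall_mem_iff_exists_perm`). -/

namespace DqAlg

open Module
open scoped TensorProduct

/-! ### Schur's bound for commutative algebras, algebraically closed case -/

section Schur

variable {K V : Type*} [Field K] [AddCommGroup V] [Module K V]

/-- The action of an algebra of endomorphisms on an invariant subspace. -/
def restrictHom (B : Subalgebra K (End K V)) (U : Submodule K V)
    (h : ∀ f ∈ B, ∀ u ∈ U, f u ∈ U) : B →ₐ[K] End K U :=
  AlgHom.ofLinearMap
    { toFun := fun f => f.1.restrict (h f.1 f.2)
      map_add' := fun _ _ => rfl
      map_smul' := fun _ _ => rfl }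
    rfl (fun _ _ => rfl)

/-- The action of an algebra of endomorphisms on the quotient by an invariant subspace. -/
def quotientHom (B : Subalgebra K (End K V)) (U : Submodule K V)
    (h : ∀ f ∈ B, ∀ u ∈ U, f u ∈ U) : B →ₐ[K] End K (V ⧸ U) :=
  AlgHom.ofLinearMap
    { toFun := fun f => U.mapQ U f.1 (h f.1 f.2)
      map_add' := fun _ _ => by ext; rfl
      map_smul' := fun _ _ => by ext; rfl }
    (by ext; rfl) (fun _ _ => by ext; rfl)

/-- The homomorphic image of a commutative subalgebra is commutative. -/
lemma IsCommSubalgebra.range {R S : Type*} [Ring R] [Algebra K R] [Ring S] [Algebra K S]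
    {B : Subalgebra K R} (hB : IsCommSubalgebra B) (φ : B →ₐ[K] S) :
    IsCommSubalgebra φ.range := by
  rintro _ ⟨x, rfl⟩ _ ⟨y, rfl⟩
  have h : x * y = y * x := Subtype.ext (hB x.1 x.2 y.1 y.2)
  change φ x * φ y = φ y * φ x
  rw [← map_mul, ← map_mul, h]

variable [FiniteDimensional K V]

lemma finrank_eq_range_add_ker {R S : Type*} [Ring R] [Algebra K R] [FiniteDimensional K R]
    [Ring S] [Algebra K S] (B : Subalgebra K R) (φ : B →ₐ[K] S) :
    finrank K B = finrank K φ.range + finrank K (LinearMap.ker φ.toLinearMap) := by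
  rw [← φ.toLinearMap.finrank_range_add_finrank_ker]
  rfl

/-- A commuting family of endomorphisms over an algebraically closed field has a common
eigenvector. -/
lemma exists_common_eigenvector [IsAlgClosed K] (S : Set (End K V))
    (hS : ∀ f ∈ S, ∀ g ∈ S, f * g = g * f) [Nontrivial V] :
    ∃ v : V, v ≠ 0 ∧ ∀ f ∈ S, ∃ c : K, f v = c • v := by
  suffices H : ∀ n, ∀ U : Submodule K V, finrank K U = n → U ≠ ⊥ →
      (∀ f ∈ S, ∀ u ∈ U, f u ∈ U) → ∃ v ∈ U, v ≠ 0 ∧ ∀ f ∈ S, ∃ c : K, f v = c • v by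
    obtain ⟨v, -, h⟩ := H _ ⊤ rfl top_ne_bot (fun _ _ _ _ => trivial)
    exact ⟨v, h⟩
  intro n
  induction n using Nat.strong_induction_on with
  | _ n ih =>
    intro U hn hU hinv
    by_cases hsc : ∀ f ∈ S, ∃ c : K, ∀ u ∈ U, f u = c • u
    · obtain ⟨v, hv, hv0⟩ := U.ne_bot_iff.mp hU
      exact ⟨v, hv, hv0, fun f hf => (hsc f hf).imp fun c hc => hc v hv⟩
    · push Not at hsc
      obtain ⟨f, hf, hfc⟩ := hsc
      have : Nontrivial U := Submodule.nontrivial_iff_ne_bot.mpr hU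
      obtain ⟨c, hc⟩ := End.exists_eigenvalue (f.restrict (hinv f hf))
      obtain ⟨w, hw⟩ := hc.exists_hasEigenvector
      have hw1 : f w = c • (w : V) := congrArg Subtype.val hw.apply_eq_smul
      obtain ⟨u, hu, huc⟩ := hfc c
      -- Since `f` is not scalar on `U`, its eigenspace there is a proper nonzero subspace;
      -- commutation makes it invariant under all of `S`.
      have hlt : U ⊓ End.eigenspace f c < U := by
        refine lt_of_le_of_ne inf_le_left fun h => huc ?_
        exact End.mem_eigenspace_iff.mp (inf_eq_left.mp h hu)
      obtain ⟨v, hv, h⟩ := ih _ (hn ▸ Submodule.finrank_lt_finrank_of_lt hlt)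
        (U ⊓ End.eigenspace f c) rfl
        (fun h => hw.2 (Subtype.ext ((Submodule.eq_bot_iff _).mp h w
          ⟨w.2, End.mem_eigenspace_iff.mpr hw1⟩)))
        (by
          rintro g hg x ⟨hxU, hx⟩
          refine ⟨hinv g hg x hxU, End.mem_eigenspace_iff.mpr ?_⟩
          have h1 := LinearMap.congr_fun (hS f hf g hg) x
          simp only [Module.End.mul_apply] at h1
          rw [h1, End.mem_eigenspace_iff.mp hx, map_smul])
      exact ⟨v, hv.1, h⟩

/-- A commuting family of endomorphisms over an algebraically closed field has an invariant
hyperplane. -/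
lemma exists_invariant_hyperplane [IsAlgClosed K] (S : Set (End K V))
    (hS : ∀ f ∈ S, ∀ g ∈ S, f * g = g * f) [Nontrivial V] :
    ∃ η : Dual K V, η ≠ 0 ∧ ∀ f ∈ S, ∀ v, η v = 0 → η (f v) = 0 := by
  obtain ⟨η, h0, h⟩ := exists_common_eigenvector (V := Dual K V)
    (LinearMap.dualMap '' S : Set (End K (Dual K V))) (by
      rintro _ ⟨f, hf, rfl⟩ _ ⟨g, hg, rfl⟩
      ext φ v
      have h1 := LinearMap.congr_fun (hS f hf g hg) v
      simp only [Module.End.mul_apply] at h1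
      simp [h1])
  refine ⟨η, h0, fun f hf v hv => ?_⟩
  obtain ⟨c, hc⟩ := h _ ⟨f, hf, rfl⟩
  have := LinearMap.congr_fun hc v
  simpa [hv] using this

end Schur

/-- **Schur's theorem** over an algebraically closed field. -/
lemma finrank_comm_le_of_isAlgClosed {K : Type*} [Field K] [IsAlgClosed K] (n : ℕ) :
    ∀ (V : Type*) [AddCommGroup V] [Module K V] [FiniteDimensional K V],
      finrank K V = n → ∀ B : Subalgebra K (End K V), IsCommSubalgebra B →
      finrank K B ≤ n ^ 2 / 4 + 1 := by
  induction n with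
  | zero =>
    intro V _ _ _ hV B _
    have := B.toSubmodule.finrank_le
    rw [Module.finrank_linearMap, hV] at this
    exact this.trans (by simp)
  | succ n ih =>
    intro V _ _ _ hV B hB
    rcases Nat.eq_zero_or_pos n with rfl | hpos
    · have := B.toSubmodule.finrank_le
      rw [Module.finrank_linearMap, hV] at this
      exact this.trans (by simp)
    have : Nontrivial V := Module.nontrivial_of_finrank_pos (R := K) (by omega)
    obtain ⟨η, hη, hηB⟩ := exists_invariant_hyperplane (B : Set (End K V)) hB
    set H := LinearMap.ker η with hH
    have hHinv : ∀ f ∈ B, ∀ u ∈ H, f u ∈ H := fun f hf u hu => hηB f hf u hu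
    obtain ⟨w, hw⟩ : ∃ w, η w ≠ 0 := by
      by_contra! h
      exact hη (LinearMap.ext h)
    have hHrank : finrank K H = n := by
      have h1 := η.finrank_range_add_finrank_ker
      rw [LinearMap.range_eq_top.mpr (LinearMap.surjective hη), finrank_top, finrank_self, hV] at h1
      change 1 + finrank K H = n + 1 at h1
      omega
    have : Nontrivial H := Module.nontrivial_of_finrank_pos (R := K) (by omega)
    let ρ := restrictHom B H hHinv
    have hρ : IsCommSubalgebra ρ.range := hB.range ρ
    -- The eigenvector is sought inside `H` so that the line `U` lies in `H`; the orthogonality of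
    -- the two kernels below depends on this.
    obtain ⟨⟨u, huH⟩, hu0, hu⟩ := exists_common_eigenvector (ρ.range : Set (End K H)) hρ
    have hu0 : u ≠ 0 := fun h => hu0 (Subtype.ext h)
    have hu : ∀ f ∈ B, ∃ c : K, f u = c • u := fun f hf => by
      obtain ⟨c, hc⟩ := hu (ρ ⟨f, hf⟩) ⟨_, rfl⟩
      exact ⟨c, congrArg Subtype.val hc⟩
    set U := K ∙ u with hU
    have hUinv : ∀ f ∈ B, ∀ x ∈ U, f x ∈ U := by
      intro f hf x hx
      obtain ⟨a, rfl⟩ := Submodule.mem_span_singleton.mp hx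
      obtain ⟨c, hc⟩ := hu f hf
      rw [map_smul, hc]
      exact U.smul_mem _ (U.smul_mem _ (Submodule.mem_span_singleton_self u))
    let π := quotientHom B U hUinv
    have hquot : finrank K (V ⧸ U) = n := by
      have h1 := U.finrank_quotient_add_finrank
      rw [finrank_span_singleton hu0, hV] at h1
      omega
    have hb1 := ih H hHrank ρ.range hρ
    have hb2 := ih (V ⧸ U) hquot π.range (hB.range π)
    have hd1 := finrank_eq_range_add_ker B ρ
    have hd2 := finrank_eq_range_add_ker B π
    obtain ⟨θ, hθ⟩ : ∃ θ : Dual K V, θ u ≠ 0 := by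
      by_contra! h
      exact hu0 ((Module.forall_dual_apply_eq_zero_iff K u).mp h)
    have hker1 : ∀ f ∈ LinearMap.ker ρ.toLinearMap, ∀ x ∈ H, f.1 x = 0 := by
      intro f hf x hx
      have h1 := LinearMap.congr_fun (LinearMap.mem_ker.mp hf) ⟨x, hx⟩
      exact congrArg Subtype.val h1
    have hker2 : ∀ f ∈ LinearMap.ker π.toLinearMap, ∀ x, f.1 x ∈ U := by
      intro f hf x
      have h1 := LinearMap.congr_fun (LinearMap.mem_ker.mp hf) (Submodule.Quotient.mk x)
      exact (Submodule.Quotient.mk_eq_zero U).mp h1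
    -- the kernel of the restriction to `H` embeds into `V` by evaluation at `w`
    let e1 : LinearMap.ker ρ.toLinearMap →ₗ[K] V :=
      { toFun := fun f => f.1.1 w
        map_add' := fun _ _ => rfl
        map_smul' := fun _ _ => rfl }
    have he1 : Function.Injective e1 := by
      refine (injective_iff_map_eq_zero _).mpr fun f hf => ?_
      refine Subtype.ext (Subtype.ext (LinearMap.ext fun x => ?_))
      have hfw : f.1.1 w = 0 := hf
      have hx : x - (η x / η w) • w ∈ H := by
        simp [H, hw]
      have h1 := hker1 f.1 f.2 _ hx
      rw [map_sub, map_smul, hfw, smul_zero, sub_zero] at h1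
      exact h1
    -- the kernel of the action on `V ⧸ U` embeds into the dual of `V`
    let e2 : LinearMap.ker π.toLinearMap →ₗ[K] Dual K V :=
      { toFun := fun f => θ ∘ₗ f.1.1
        map_add' := fun _ _ => LinearMap.comp_add _ _ _
        map_smul' := fun _ _ => LinearMap.comp_smul _ _ _ }
    have he2 : Function.Injective e2 := by
      refine (injective_iff_map_eq_zero _).mpr fun f hf => ?_
      refine Subtype.ext (Subtype.ext (LinearMap.ext fun x => ?_))
      have h1 : θ (f.1.1 x) = 0 := LinearMap.congr_fun hf x
      obtain ⟨a, ha⟩ := Submodule.mem_span_singleton.mp (hker2 f.1 f.2 x)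
      rw [← ha, map_smul, smul_eq_mul] at h1
      have : a = 0 := (mul_eq_zero.mp h1).resolve_right hθ
      change f.1.1 x = 0
      rw [← ha, this, zero_smul]
    -- For f killing V ⧸ U and g killing H, f (g w) = g (f w) = 0 because f w ∈ U ≤ H. Hence the two
    -- kernels have total dimension at most n + 1.
    have hle : LinearMap.range e2 ≤ (LinearMap.range e1).dualAnnihilator := by
      rintro _ ⟨f, rfl⟩
      rw [Submodule.mem_dualAnnihilator]
      rintro _ ⟨g, rfl⟩
      change θ (f.1.1 (g.1.1 w)) = 0
      have h1 := LinearMap.congr_fun (hB f.1.1 f.1.2 g.1.1 g.1.2) w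
      simp only [Module.End.mul_apply] at h1
      rw [h1, hker1 g.1 g.2 _ ?_, map_zero]
      exact (Submodule.span_singleton_le_iff_mem u H).mpr huH (hker2 f.1 f.2 w)
    have hsum := Submodule.finrank_mono hle
    have hann := Subspace.finrank_add_finrank_dualAnnihilator_eq (LinearMap.range e1)
    rw [LinearMap.finrank_range_of_inj he1] at hann
    rw [LinearMap.finrank_range_of_inj he2] at hsum
    -- Adding the two rank-nullity formulas gives 2 dim B ≤ 2(⌊n²/4⌋ + 1) + (n + 1); halving is
    -- exactly the induction step.
    have harith : (n + 1) ^ 2 / 4 = n ^ 2 / 4 + (n + 1) / 2 := by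
      rcases Nat.even_or_odd' n with ⟨k, rfl | rfl⟩ <;> ring_nf <;> omega
    omega

/-! ### Schur's bound over an arbitrary field, by extension of scalars -/

section Schur

variable {K V : Type*} [Field K] [AddCommGroup V] [Module K V] [FiniteDimensional K V]

/-- A family of matrices that is linearly independent over `K` is linearly independent over each
extension field of `K`. -/
lemma linearIndependent_map_algebraMap {L ι m n : Type*} [Field L] [Algebra K L] [Fintype m]
    [Fintype n] {b : ι → Matrix m n K} (hb : LinearIndependent K b) :
    LinearIndependent L (fun i => (b i).map (algebraMap K L)) := by
  classical
  let c : Matrix m n K ≃ₗ[K] (m × n → K) := (LinearEquiv.curry K K m n).symm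
  have h1 : LinearIndependent K (fun i => c (b i)) := hb.map' c.toLinearMap c.ker
  have h2 := Module.Flat.linearIndependent_one_tmul (S := L) h1
  have h3 := h2.map' (TensorProduct.piScalarRight K L L (m × n)).toLinearMap
    (LinearEquiv.ker _)
  let c' : (m × n → L) ≃ₗ[L] Matrix m n L := LinearEquiv.curry L L m n
  have h4 := h3.map' c'.toLinearMap c'.ker
  have h5 : (fun i => (b i).map (algebraMap K L)) =
      fun i => c' (TensorProduct.piScalarRight K L L (m × n) (1 ⊗ₜ[K] c (b i))) := by
    ext i x y
    simp only [Matrix.map_apply, TensorProduct.piScalarRight_apply,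
      TensorProduct.piScalarRightHom_tmul, Algebra.algebraMap_eq_smul_one]
    rfl
  rw [h5]
  exact h4

/-- **Schur's theorem** for matrices over an arbitrary field. -/
theorem finrank_comm_matrix_le {n : ℕ} (B : Subalgebra K (Matrix (Fin n) (Fin n) K))
    (hB : IsCommSubalgebra B) : finrank K B ≤ n ^ 2 / 4 + 1 := by
  let L := AlgebraicClosure K
  let S : Set (Matrix (Fin n) (Fin n) L) := (fun M : Matrix (Fin n) (Fin n) K => M.map (algebraMap K L)) '' B
  let C := Algebra.adjoin L S
  have hC : IsCommSubalgebra C := by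
    have hS : ∀ x ∈ S, ∀ y ∈ S, x * y = y * x := by
      rintro _ ⟨x, hx, rfl⟩ _ ⟨y, hy, rfl⟩
      change x.map _ * y.map _ = y.map _ * x.map _
      rw [← Matrix.map_mul, ← Matrix.map_mul, hB x hx y hy]
    intro x hx y hy
    have := Algebra.isMulCommutative_adjoin L hS
    exact congrArg Subtype.val (isMulCommutative_iff.mp this (⟨x, hx⟩ : C) ⟨y, hy⟩)
  let e := (Matrix.toLinAlgEquiv' : Matrix (Fin n) (Fin n) L ≃ₐ[L] _)
  have h1 : finrank L (C.map e.toAlgHom) ≤ n ^ 2 / 4 + 1 := by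
    refine finrank_comm_le_of_isAlgClosed n (Fin n → L) (by simp) _ ?_
    rintro _ ⟨x, hx, rfl⟩ _ ⟨y, hy, rfl⟩
    change e x * e y = e y * e x
    rw [← map_mul, ← map_mul, hC x hx y hy]
  have h2 : finrank L (C.map e.toAlgHom) = finrank L C :=
    LinearEquiv.finrank_map_eq e.toLinearEquiv C.toSubmodule
  let b := finBasis K B
  have hb : LinearIndependent K (fun i => (b i : Matrix (Fin n) (Fin n) K)) :=
    b.linearIndependent.map' B.val.toLinearMap
      (LinearMap.ker_eq_bot.mpr Subtype.val_injective)
  have hbL := linearIndependent_map_algebraMap (L := L) hb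
  have hbC : LinearIndependent L
      (fun i => (⟨_, Algebra.subset_adjoin ⟨b i, (b i).2, rfl⟩⟩ : C)) :=
    LinearIndependent.of_comp C.val.toLinearMap hbL
  have := hbC.fintype_card_le_finrank
  rw [Fintype.card_fin] at this
  omega

/-- **Schur's theorem** for endomorphisms over an arbitrary field. -/
theorem finrank_comm_end_le (B : Subalgebra K (End K V)) (hB : IsCommSubalgebra B) :
    finrank K B ≤ finrank K V ^ 2 / 4 + 1 := by
  let e := LinearMap.toMatrixAlgEquiv (finBasis K V)
  have h1 : finrank K (B.map e.toAlgHom) ≤ finrank K V ^ 2 / 4 + 1 := by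
    refine finrank_comm_matrix_le _ ?_
    rintro _ ⟨x, hx, rfl⟩ _ ⟨y, hy, rfl⟩
    change e x * e y = e y * e x
    rw [← map_mul, ← map_mul, hB x hx y hy]
  have h2 : finrank K (B.map e.toAlgHom) = finrank K B :=
    LinearEquiv.finrank_map_eq e.toLinearEquiv B.toSubmodule
  omega

end Schur

/-! ### The upper bound for all algebras satisfying the identity -/

section UpperBound

/-- Over a ring homomorphic image, products of commutators lift. -/
lemma exists_lift_commutator_prod {K R S : Type*} [Field K] [Ring R] [Algebra K R] [Ring S]
    [Algebra K S] (φ : R →ₐ[K] S) {q : ℕ} (x y : Fin q → S) (hx : ∀ i, x i ∈ φ.range)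
    (hy : ∀ i, y i ∈ φ.range) : ∃ x' y' : Fin q → R,
      φ (List.ofFn fun i => x' i * y' i - y' i * x' i).prod =
        (List.ofFn fun i => x i * y i - y i * x i).prod := by
  choose x' hx' using hx
  choose y' hy' using hy
  refine ⟨x', y', ?_⟩
  rw [map_list_prod, List.map_ofFn]
  congr 2
  ext i
  have h1 : φ (x' i) = x i := hx' i
  have h2 : φ (y' i) = y i := hy' i
  simp [h1, h2]

lemma coe_commutator_prod {K R : Type*} [Field K] [Ring R] [Algebra K R]
    {B : Subalgebra K R} {q : ℕ} (x y : Fin q → B) :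
    (((List.ofFn fun i => x i * y i - y i * x i).prod : B) : R) =
      (List.ofFn fun i => (x i : R) * y i - y i * x i).prod := by
  have h := map_list_prod B.val (List.ofFn fun i => x i * y i - y i * x i)
  rw [List.map_ofFn] at h
  exact h

/-- The homomorphic image of an algebra satisfying `[x₁, y₁] ⋯ [x_q, y_q] = 0` satisfies the same
identity. -/
lemma SatisfiesDq.range {K R S : Type*} [Field K] [Ring R] [Algebra K R] [Ring S]
    [Algebra K S] {B : Subalgebra K R} {q : ℕ} (hB : SatisfiesDq q B) (φ : B →ₐ[K] S) :
    SatisfiesDq q φ.range := by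
  intro x y hx hy
  obtain ⟨x', y', h⟩ := exists_lift_commutator_prod φ x y hx hy
  rw [← h, (Subtype.ext ((coe_commutator_prod x' y').trans
    (hB _ _ (fun i => (x' i).2) (fun i => (y' i).2))) :
    (List.ofFn fun i => x' i * y' i - y' i * x' i).prod = 0), map_zero]

variable {K V : Type*} [Field K] [AddCommGroup V] [Module K V]

/-- The common kernel of all the commutators of elements of `B`. -/
def commutatorKernel (B : Subalgebra K (End K V)) : Submodule K V where
  carrier := {v | ∀ f ∈ B, ∀ g ∈ B, f (g v) = g (f v)}
  add_mem' := fun hv hw f hf g hg => by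
    rw [map_add, map_add, map_add, map_add, hv f hf g hg, hw f hf g hg]
  zero_mem' := fun f _ g _ => by simp only [map_zero]
  smul_mem' := fun c v hv f hf g hg => by
    rw [map_smul, map_smul, map_smul, map_smul, hv f hf g hg]

/-- For u in the kernel, f g b u = g b f u, as f commutes with g b on u, and b f u = f b u. -/
lemma commutatorKernel_invariant (B : Subalgebra K (End K V)) :
    ∀ f ∈ B, ∀ u ∈ commutatorKernel B, f u ∈ commutatorKernel B := by
  intro b hb u hu f hf g hg
  have h1 : f (g (b u)) = g (b (f u)) := hu f hf (g * b) (B.mul_mem hg hb)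
  rw [h1, hu b hb f hf]

lemma isCommSubalgebra_restrictHom_range (B : Subalgebra K (End K V)) :
    IsCommSubalgebra
      (restrictHom B (commutatorKernel B) (commutatorKernel_invariant B)).range := by
  rintro _ ⟨f, rfl⟩ _ ⟨g, rfl⟩
  ext u
  exact u.2 f.1 f.2 g.1 g.2

/-- Putting any commutator in front of a product of q commutators gives zero, so such a product maps
V into the common kernel and vanishes on the quotient. -/
lemma SatisfiesDq.quotientHom_range {B : Subalgebra K (End K V)} {q : ℕ}
    (hB : SatisfiesDq (q + 1) B) :
    SatisfiesDq q (quotientHom B (commutatorKernel B) (commutatorKernel_invariant B)).range := by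
  intro x y hx hy
  obtain ⟨x', y', h⟩ := exists_lift_commutator_prod _ x y hx hy
  rw [← h]
  ext v
  change Submodule.Quotient.mk _ = 0
  rw [Submodule.Quotient.mk_eq_zero]
  intro f hf g hg
  have h1 := hB (Fin.cons f fun i => x' i) (Fin.cons g fun i => y' i)
    (Fin.cases hf fun i => by simp) (Fin.cases hg fun i => by simp)
  rw [List.ofFn_succ, List.prod_cons] at h1
  simp only [Fin.cons_zero, Fin.cons_succ] at h1
  rw [← coe_commutator_prod] at h1
  have h2 := LinearMap.congr_fun h1 v
  rw [Module.End.mul_apply, LinearMap.sub_apply] at h2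
  exact sub_eq_zero.mp h2

/-- The dimension of an algebra of endomorphisms leaving `U` invariant is at most the sum of the
dimensions of its actions on `V ⧸ U` and on `U`, and of `Hom(V ⧸ U, U)`. -/
lemma finrank_le_of_invariant [FiniteDimensional K V] (B : Subalgebra K (End K V))
    (U : Submodule K V) (h : ∀ f ∈ B, ∀ u ∈ U, f u ∈ U) :
    finrank K B ≤ finrank K (quotientHom B U h).range + finrank K (restrictHom B U h).range +
      finrank K (V ⧸ U) * finrank K U := by
  set ρ := restrictHom B U h
  set π := quotientHom B U h
  let Φ := π.rangeRestrict.prod ρ.rangeRestrict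
  have := Module.Free.of_divisionRing K π.range
  have := Module.Free.of_divisionRing K ρ.range
  have h1 := finrank_eq_range_add_ker (S := π.range × ρ.range) B Φ
  have h2 := Submodule.finrank_le (Subalgebra.toSubmodule Φ.range)
  have h3 : finrank K (π.range × ρ.range) = finrank K π.range + finrank K ρ.range :=
    Module.finrank_prod
  rw [h1, ← h3, ← Module.finrank_linearMap K K (V ⧸ U) U]
  refine Nat.add_le_add h2 ?_
  have hker : ∀ f ∈ LinearMap.ker Φ.toLinearMap, π f = 0 ∧ ρ f = 0 := fun f hf =>
    ⟨congrArg (fun x => (x.1 : End K (V ⧸ U))) (LinearMap.mem_ker.mp hf),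
      congrArg (fun x => (x.2 : End K U)) (LinearMap.mem_ker.mp hf)⟩
  have hπ : ∀ f ∈ LinearMap.ker Φ.toLinearMap, ∀ x, f.1 x ∈ U := fun f hf x =>
    (Submodule.Quotient.mk_eq_zero U).mp
      (LinearMap.congr_fun (hker f hf).1 (Submodule.Quotient.mk x))
  have hρ : ∀ f ∈ LinearMap.ker Φ.toLinearMap, ∀ x ∈ U, f.1 x = 0 := fun f hf x hx =>
    congrArg Subtype.val (LinearMap.congr_fun (hker f hf).2 ⟨x, hx⟩)
  let e : LinearMap.ker Φ.toLinearMap →ₗ[K] ((V ⧸ U) →ₗ[K] U) :=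
    { toFun := fun f => U.liftQ (f.1.1.codRestrict U (hπ f.1 f.2))
        fun x hx => LinearMap.mem_ker.mpr (Subtype.ext (hρ f.1 f.2 x hx))
      map_add' := fun _ _ => by ext; rfl
      map_smul' := fun _ _ => by ext; rfl }
  refine LinearMap.finrank_le_finrank_of_injective (f := e) ?_
  refine (injective_iff_map_eq_zero _).mpr fun f hf => ?_
  refine Subtype.ext (Subtype.ext (LinearMap.ext fun x => ?_))
  exact congrArg Subtype.val (LinearMap.congr_fun hf (Submodule.Quotient.mk x))

end UpperBound

/-- Right side minus left side is 2(a - k)(a - k - 1) for m = 2a and 2(a - k)² for m = 2a + 1; the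
first is nonnegative because a and k are integers. -/
lemma tangent_le (m k : ℕ) :
    (2 * k + 1 : ℤ) * m + 2 * ((m ^ 2 / 4 : ℕ) : ℤ) ≤ (m : ℤ) ^ 2 + 2 * k * (k + 1) := by
  rcases Nat.even_or_odd' m with ⟨a, rfl | rfl⟩
  · have h : (2 * a) ^ 2 / 4 = a ^ 2 := by
      rw [mul_pow]; omega
    rw [h]
    push_cast
    rcases le_or_gt a k with hak | hak
    · have h1 : (a : ℤ) ≤ k := by exact_mod_cast hak
      nlinarith [mul_nonneg (sub_nonneg.mpr h1) (by linarith : (0 : ℤ) ≤ k + 1 - a)]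
    · have h1 : (k : ℤ) + 1 ≤ a := by exact_mod_cast hak
      nlinarith [mul_nonneg (sub_nonneg.mpr h1) (by linarith : (0 : ℤ) ≤ a - k)]
  · have h : (2 * a + 1) ^ 2 / 4 = a ^ 2 + a := by
      have : (2 * a + 1) ^ 2 = 4 * (a ^ 2 + a) + 1 := by ring
      omega
    rw [h]
    push_cast
    nlinarith [sq_nonneg ((a : ℤ) - k)]

lemma tangent_eq_iff (m k : ℕ) :
    (2 * k + 1 : ℤ) * m + 2 * ((m ^ 2 / 4 : ℕ) : ℤ) = (m : ℤ) ^ 2 + 2 * k * (k + 1) ↔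
      m = 2 * k ∨ m = 2 * k + 1 ∨ m = 2 * k + 2 := by
  rcases Nat.even_or_odd' m with ⟨a, rfl | rfl⟩
  · have h : (2 * a) ^ 2 / 4 = a ^ 2 := by
      rw [mul_pow]; omega
    rw [h]
    push_cast
    have h2 : (2 * k + 1 : ℤ) * (2 * a) + 2 * a ^ 2 = (2 * a) ^ 2 + 2 * k * (k + 1) ↔
        ((a : ℤ) - k) * (a - k - 1) = 0 := by
      constructor <;> intro h <;> linarith
    rw [h2, mul_eq_zero]
    omega
  · have h : (2 * a + 1) ^ 2 / 4 = a ^ 2 + a := by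
      have : (2 * a + 1) ^ 2 = 4 * (a ^ 2 + a) + 1 := by ring
      omega
    rw [h]
    push_cast
    have h2 : (2 * k + 1 : ℤ) * (2 * a + 1) + 2 * (a ^ 2 + a) =
        (2 * a + 1) ^ 2 + 2 * k * (k + 1) ↔ ((a : ℤ) - k) ^ 2 = 0 := by
      constructor <;> intro h <;> linarith
    rw [h2, sq_eq_zero_iff]
    omega

/-- A bound, for each `k`, for the dimension of an algebra of endomorphisms that satisfies the
identity `[x₁, y₁] ⋯ [x_q, y_q] = 0`. -/
theorem SatisfiesDq.two_mul_finrank_le {K : Type*} [Field K] (k q : ℕ) :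
    ∀ (V : Type*) [AddCommGroup V] [Module K V] [FiniteDimensional K V]
      (B : Subalgebra K (End K V)), SatisfiesDq q B →
      2 * (finrank K B : ℤ) + (2 * k + 1) * finrank K V ≤
        (finrank K V : ℤ) ^ 2 + 2 * q + 2 * q * k * (k + 1) := by
  induction q with
  | zero =>
    intro V _ _ _ B hB
    -- The empty product is 1, so the identity with no factors forces V = 0.
    have h1 : (1 : End K V) = 0 := by simpa using hB Fin.elim0 Fin.elim0 (by simp) (by simp)
    have : Subsingleton V := ⟨fun x y => by
      have hx := LinearMap.congr_fun h1 x
      have hy := LinearMap.congr_fun h1 y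
      simp only [Module.End.one_apply, LinearMap.zero_apply] at hx hy
      rw [hx, hy]⟩
    have hV : finrank K V = 0 := finrank_zero_of_subsingleton
    have h2 := B.toSubmodule.finrank_le
    rw [Module.finrank_linearMap, hV] at h2
    have h3 : finrank K B = 0 := by simpa using h2
    simp [hV, h3]
  | succ q ih =>
    intro V _ _ _ B hB
    have h1 := finrank_le_of_invariant B (commutatorKernel B) (commutatorKernel_invariant B)
    have h2 := ih _ _ hB.quotientHom_range
    have h3 := finrank_comm_end_le _ (isCommSubalgebra_restrictHom_range B)
    have h4 := (commutatorKernel B).finrank_quotient_add_finrank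
    have h5 := tangent_le (finrank K (commutatorKernel B)) k
    rw [← h4]
    generalize finrank K (commutatorKernel B) = m at *
    generalize finrank K (V ⧸ commutatorKernel B) = l at *
    generalize hs : m ^ 2 / 4 = s at *
    zify at h1 h3
    push_cast
    -- With l² + 2lm + m² = (l + m)², the induction hypothesis for l and the tangent inequality for
    -- m add up to the claim.
    nlinarith

/-- A bound, for each `k`, for the dimension of an algebra of matrices that satisfies the
identity `[x₁, y₁] ⋯ [x_q, y_q] = 0`. -/
theorem SatisfiesDq.two_mul_finrank_matrix_le {K : Type*} [Field K] (k q n : ℕ)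
    (B : Subalgebra K (Matrix (Fin n) (Fin n) K)) (hB : SatisfiesDq q B) :
    2 * (finrank K B : ℤ) + (2 * k + 1) * n ≤ (n : ℤ) ^ 2 + 2 * q + 2 * q * k * (k + 1) := by
  let e := (Matrix.toLinAlgEquiv' : Matrix (Fin n) (Fin n) K ≃ₐ[K] _)
  let φ : B →ₐ[K] End K (Fin n → K) := e.toAlgHom.comp B.val
  have hφ : Function.Injective φ := e.injective.comp Subtype.val_injective
  have h1 := SatisfiesDq.two_mul_finrank_le k q _ _ (hB.range φ)
  have h2 : finrank K φ.range = finrank K B :=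
    LinearMap.finrank_range_of_inj (f := φ.toLinearMap) hφ
  rw [h2] at h1
  simpa using h1

/-! ### Commutative algebras attaining Schur's bound -/

section Commutative

variable {K : Type*} [Field K]

/-- The matrices with block form `(c, N; 0, c)` where `c` is a scalar. -/
def scalarBlockSubalgebra (K : Type*) [Field K] (a b : ℕ) :
    Subalgebra K (Matrix (Fin a ⊕ Fin b) (Fin a ⊕ Fin b) K) where
  carrier := {M | ∃ (c : K) (N : Matrix (Fin a) (Fin b) K),
    M = Matrix.fromBlocks (c • 1) N 0 (c • 1)}
  mul_mem' := by
    rintro _ _ ⟨c, N, rfl⟩ ⟨c', N', rfl⟩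
    exact ⟨c * c', c • N' + c' • N, by simp [Matrix.fromBlocks_multiply, smul_smul, mul_comm]⟩
  add_mem' := by
    rintro _ _ ⟨c, N, rfl⟩ ⟨c', N', rfl⟩
    exact ⟨c + c', N + N', by simp [Matrix.fromBlocks_add, add_smul]⟩
  algebraMap_mem' := fun c => ⟨c, 0, by
    rw [Algebra.algebraMap_eq_smul_one, ← Matrix.fromBlocks_one, Matrix.fromBlocks_smul]
    simp⟩

lemma isCommSubalgebra_scalarBlockSubalgebra (a b : ℕ) :
    IsCommSubalgebra (scalarBlockSubalgebra K a b) := by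
  rintro _ ⟨c, N, rfl⟩ _ ⟨c', N', rfl⟩
  simp [Matrix.fromBlocks_multiply, smul_smul, mul_comm, add_comm]

/-- `hb` lets the scalar be read off from the lower right block, so it is independent of the a * b
free entries. -/
lemma le_finrank_scalarBlockSubalgebra (a b : ℕ) (hb : 0 < b) :
    a * b + 1 ≤ finrank K (scalarBlockSubalgebra K a b) := by
  let ψ : (Matrix (Fin a) (Fin b) K × K) →ₗ[K] scalarBlockSubalgebra K a b :=
    { toFun := fun p => ⟨Matrix.fromBlocks (p.2 • 1) p.1 0 (p.2 • 1), p.2, p.1, rfl⟩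
      map_add' := fun p p' => Subtype.ext (by simp [Matrix.fromBlocks_add, add_smul])
      map_smul' := fun c p => Subtype.ext (by simp [Matrix.fromBlocks_smul, smul_smul]) }
  have hψ : Function.Injective ψ := by
    rintro ⟨N, c⟩ ⟨N', c'⟩ h
    obtain ⟨-, h1, -, h2⟩ := Matrix.fromBlocks_inj.mp (congrArg Subtype.val h)
    have h3 := congrFun (congrFun h2 ⟨0, hb⟩) ⟨0, hb⟩
    simp only [Matrix.smul_apply, Matrix.one_apply_eq, smul_eq_mul, mul_one] at h3
    exact Prod.ext h1 h3
  have h := LinearMap.finrank_le_finrank_of_injective hψ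
  rwa [Module.finrank_prod, Module.finrank_matrix, finrank_self, Fintype.card_fin,
    Fintype.card_fin, mul_one] at h

/-- A commutative subalgebra of `M_m(K)` of dimension `⌊m² / 4⌋ + 1`. -/
lemma exists_comm_finrank_eq {m : ℕ} (hm : 0 < m) :
    ∃ C : Subalgebra K (Matrix (Fin m) (Fin m) K), IsCommSubalgebra C ∧
      finrank K C = m ^ 2 / 4 + 1 := by
  let e : Fin (m / 2) ⊕ Fin (m - m / 2) ≃ Fin m := finSumFinEquiv.trans (finCongr (by omega))
  let φ := Matrix.reindexAlgEquiv K K e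
  let S := scalarBlockSubalgebra K (m / 2) (m - m / 2)
  have hcomm : IsCommSubalgebra (S.map φ.toAlgHom) := by
    rintro _ ⟨x, hx, rfl⟩ _ ⟨y, hy, rfl⟩
    change φ x * φ y = φ y * φ x
    rw [← map_mul, ← map_mul, isCommSubalgebra_scalarBlockSubalgebra _ _ x hx y hy]
  refine ⟨S.map φ.toAlgHom, hcomm, (finrank_comm_matrix_le _ hcomm).antisymm ?_⟩
  have h1 : finrank K (S.map φ.toAlgHom) = finrank K S :=
    LinearEquiv.finrank_map_eq φ.toLinearEquiv (Subalgebra.toSubmodule S)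
  have h2 := le_finrank_scalarBlockSubalgebra (K := K) (m / 2) (m - m / 2) (by omega)
  have h3 : m ^ 2 / 4 = m / 2 * (m - m / 2) := by
    rcases Nat.even_or_odd' m with ⟨a, rfl | rfl⟩
    · rw [show 2 * a / 2 = a by omega, show 2 * a - a = a by omega, mul_pow, ← sq]
      omega
    · rw [show (2 * a + 1) / 2 = a by omega, show 2 * a + 1 - a = a + 1 by omega]
      have : (2 * a + 1) ^ 2 = 4 * (a * (a + 1)) + 1 := by ring
      omega
  rw [h1, h3]
  exact h2

lemma HasMaxDim.finrank_comm_eq {m : ℕ} (hm : 0 < m)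
    {C : Subalgebra K (Matrix (Fin m) (Fin m) K)} (hC : HasMaxDim IsCommSubalgebra C) :
    finrank K C = m ^ 2 / 4 + 1 := by
  obtain ⟨C', hC', h⟩ := exists_comm_finrank_eq (K := K) hm
  exact (finrank_comm_matrix_le C hC.1).antisymm (h ▸ hC.2 C' hC')

end Commutative

/-! ### Block calculus -/

section Blocks

variable {K : Type*} {n q : ℕ} {d : Fin q → ℕ} (h : ∑ i, d i = n)

lemma block_ext {M N : Matrix (Fin n) (Fin n) K}
    (hMN : ∀ i j, block d h M i j = block d h N i j) : M = N := by
  ext x y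
  obtain ⟨⟨i, a⟩, rfl⟩ := (blockIndex d h).surjective x
  obtain ⟨⟨j, b⟩, rfl⟩ := (blockIndex d h).surjective y
  exact congrFun (congrFun (hMN i j) a) b

/-- The matrix with given blocks. -/
def ofBlocks (f : ∀ i j : Fin q, Matrix (Fin (d i)) (Fin (d j)) K) :
    Matrix (Fin n) (Fin n) K :=
  Matrix.of fun x y => f ((blockIndex d h).symm x).1 ((blockIndex d h).symm y).1
    ((blockIndex d h).symm x).2 ((blockIndex d h).symm y).2

@[simp] lemma block_ofBlocks (f : ∀ i j : Fin q, Matrix (Fin (d i)) (Fin (d j)) K) (i j : Fin q) :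
    block d h (ofBlocks h f) i j = f i j := by
  ext a b
  simp only [block, ofBlocks, Matrix.submatrix_apply, Matrix.of_apply]
  rw [Equiv.symm_apply_apply, Equiv.symm_apply_apply]

variable [Field K]

lemma block_add (M N : Matrix (Fin n) (Fin n) K) (i j : Fin q) :
    block d h (M + N) i j = block d h M i j + block d h N i j := rfl

lemma block_sub (M N : Matrix (Fin n) (Fin n) K) (i j : Fin q) :
    block d h (M - N) i j = block d h M i j - block d h N i j := rfl

lemma block_smul (c : K) (M : Matrix (Fin n) (Fin n) K) (i j : Fin q) :
    block d h (c • M) i j = c • block d h M i j := rfl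

lemma block_one_self (i : Fin q) : block d h (1 : Matrix (Fin n) (Fin n) K) i i = 1 := by
  ext a b
  simp [block, Matrix.one_apply]

lemma block_one_of_ne {i j : Fin q} (hij : i ≠ j) :
    block d h (1 : Matrix (Fin n) (Fin n) K) i j = 0 := by
  ext a b
  simp [block, hij]

lemma block_mul (M N : Matrix (Fin n) (Fin n) K) (i j : Fin q) :
    block d h (M * N) i j = ∑ l, block d h M i l * block d h N l j := by
  ext a b
  rw [Matrix.sum_apply]
  simp only [block, Matrix.submatrix_apply, Matrix.mul_apply]
  rw [← (blockIndex d h).sum_comp, Fintype.sum_sigma]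

lemma block_mul_self_of_lower_zero {M N : Matrix (Fin n) (Fin n) K}
    (hM : ∀ i j, j < i → block d h M i j = 0) (hN : ∀ i j, j < i → block d h N i j = 0)
    (i : Fin q) : block d h (M * N) i i = block d h M i i * block d h N i i := by
  rw [block_mul, Finset.sum_eq_single i]
  · intro l _ hl
    rcases lt_or_gt_of_ne hl with hl | hl
    · rw [hM i l hl, Matrix.zero_mul]
    · rw [hN l i hl, Matrix.mul_zero]
  · simp

/-- If the blocks of `M` and `N` vanish below the `p`-th and `p'`-th block superdiagonal, then
those of `M * N` vanish below the `(p + p')`-th. -/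
lemma block_mul_eq_zero {M N : Matrix (Fin n) (Fin n) K} {p p' : ℕ}
    (hM : ∀ i j : Fin q, (j : ℕ) < i + p → block d h M i j = 0)
    (hN : ∀ i j : Fin q, (j : ℕ) < i + p' → block d h N i j = 0) (i j : Fin q)
    (hij : (j : ℕ) < i + (p + p')) : block d h (M * N) i j = 0 := by
  rw [block_mul]
  refine Finset.sum_eq_zero fun l _ => ?_
  by_cases hl : (l : ℕ) < i + p
  · rw [hM i l hl, Matrix.zero_mul]
  · rw [hN l j (by omega), Matrix.mul_zero]

/-- The block triangular subalgebra with diagonal blocks in `D`. -/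
def blockTriangularSubalgebra (D : (i : Fin q) → Subalgebra K (Matrix (Fin (d i)) (Fin (d i)) K)) :
    Subalgebra K (Matrix (Fin n) (Fin n) K) where
  carrier := {M | (∀ i, block d h M i i ∈ D i) ∧ ∀ i j, j < i → block d h M i j = 0}
  mul_mem' := by
    rintro M N ⟨hM, hM0⟩ ⟨hN, hN0⟩
    refine ⟨fun i => ?_, fun i j hij => ?_⟩
    · rw [block_mul_self_of_lower_zero h hM0 hN0]
      exact (D i).mul_mem (hM i) (hN i)
    · exact block_mul_eq_zero h (p := 0) (p' := 0) hM0 hN0 i j hij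
  add_mem' := by
    rintro M N ⟨hM, hM0⟩ ⟨hN, hN0⟩
    refine ⟨fun i => ?_, fun i j hij => ?_⟩
    · rw [block_add]
      exact (D i).add_mem (hM i) (hN i)
    · rw [block_add, hM0 i j hij, hN0 i j hij, add_zero]
  algebraMap_mem' := by
    intro c
    rw [Algebra.algebraMap_eq_smul_one]
    refine ⟨fun i => ?_, fun i j hij => ?_⟩
    · rw [block_smul, block_one_self]
      exact (D i).smul_mem (D i).one_mem c
    · rw [block_smul, block_one_of_ne h hij.ne', smul_zero]

lemma isOfType_blockTriangularSubalgebra (hq : 2 ≤ q) (hd : ∀ i, 0 < d i)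
    (D : (i : Fin q) → Subalgebra K (Matrix (Fin (d i)) (Fin (d i)) K)) :
    IsOfType d D (blockTriangularSubalgebra h D) :=
  ⟨hq, hd, h, fun _ => Iff.rfl⟩

end Blocks

/-! ### Block triangular algebras: the identity and the dimension -/

section IsOfType

variable {K : Type*} [Field K] {n q : ℕ} {d : Fin q → ℕ}
  {D : (i : Fin q) → Subalgebra K (Matrix (Fin (d i)) (Fin (d i)) K)}
  {A : Subalgebra K (Matrix (Fin n) (Fin n) K)}

lemma IsOfType.block_commutator_eq_zero (hA : IsOfType d D A)
    (hD : ∀ i, IsCommSubalgebra (D i)) {M N : Matrix (Fin n) (Fin n) K} (hM : M ∈ A) (hN : N ∈ A)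
    (i j : Fin q) (hij : (j : ℕ) < i + 1) : block d hA.sum_eq (M * N - N * M) i j = 0 := by
  obtain ⟨hM, hM0⟩ := (hA.mem_iff M).mp hM
  obtain ⟨hN, hN0⟩ := (hA.mem_iff N).mp hN
  rw [block_sub]
  rcases lt_or_eq_of_le (Nat.lt_succ_iff.mp hij) with hlt | heq
  · rw [block_mul_eq_zero hA.sum_eq (p := 0) (p' := 0) hM0 hN0 i j hlt,
      block_mul_eq_zero hA.sum_eq (p := 0) (p' := 0) hN0 hM0 i j hlt, sub_zero]
  · obtain rfl := Fin.ext heq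
    rw [block_mul_self_of_lower_zero _ hM0 hN0, block_mul_self_of_lower_zero _ hN0 hM0,
      hD j _ (hM j) _ (hN j), sub_self]

/-- Each commutator is strictly block upper triangular, so every further factor clears one more
block superdiagonal, and q factors clear them all. -/
lemma IsOfType.satisfiesDq (hA : IsOfType d D A) (hD : ∀ i, IsCommSubalgebra (D i)) :
    SatisfiesDq q A := by
  have key : ∀ (p : ℕ) (x y : Fin p → Matrix (Fin n) (Fin n) K), (∀ i, x i ∈ A) →
      (∀ i, y i ∈ A) → ∀ i j : Fin q, (j : ℕ) < i + p →
      block d hA.sum_eq (List.ofFn fun i => x i * y i - y i * x i).prod i j = 0 := by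
    intro p
    induction p with
    | zero =>
      intro x y _ _ i j hij
      rw [List.ofFn_zero, List.prod_nil]
      exact block_one_of_ne _ (Fin.ne_of_gt hij)
    | succ p ih =>
      intro x y hx hy i j hij
      rw [List.ofFn_succ, List.prod_cons]
      exact block_mul_eq_zero hA.sum_eq (p := 1) (p' := p)
        (hA.block_commutator_eq_zero hD (hx 0) (hy 0))
        (ih _ _ (fun i => hx i.succ) (fun i => hy i.succ)) i j (by omega)
  intro x y hx hy
  refine block_ext hA.sum_eq fun i j => ?_
  rw [key q x y hx hy i j (by omega)]
  rfl

lemma prod_single_apply {ι : Type*} [Fintype ι] [DecidableEq ι] {p : ℕ} (v : Fin (p + 1) → ι) :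
    (List.ofFn fun i : Fin p => Matrix.single (v i.castSucc) (v i.succ) (1 : K)).prod
      (v 0) (v (Fin.last p)) = 1 := by
  induction p with
  | zero => simp
  | succ p ih =>
    rw [List.ofFn_succ, List.prod_cons, Fin.castSucc_zero, Matrix.single_mul_apply_same, one_mul]
    exact ih (fun i => v i.succ)

/-- A chain of matrix units through the first index of each block has nonzero product. Each unit is
its own commutator with the projection onto the blocks up to its row, and that projection lies in
`A` because its diagonal blocks are 0 or 1. -/
lemma IsOfType.not_satisfiesDq {p : ℕ} {d : Fin (p + 1) → ℕ}
    {D : (i : Fin (p + 1)) → Subalgebra K (Matrix (Fin (d i)) (Fin (d i)) K)}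
    (hA : IsOfType d D A) : ¬ SatisfiesDq p A := by
  intro hS
  let e := blockIndex d hA.sum_eq
  let v : Fin (p + 1) → Fin n := fun i => e ⟨i, ⟨0, hA.pos i⟩⟩
  let x : Fin p → Matrix (Fin n) (Fin n) K := fun i =>
    Matrix.diagonal fun a => if (e.symm a).1 ≤ i.castSucc then 1 else 0
  let y : Fin p → Matrix (Fin n) (Fin n) K := fun i => Matrix.single (v i.castSucc) (v i.succ) 1
  have hx : ∀ i, x i ∈ A := by
    intro i
    rw [hA.mem_iff]
    refine ⟨fun j => ?_, fun j k hjk => ?_⟩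
    · have : block d hA.sum_eq (x i) j j = if j ≤ i.castSucc then 1 else 0 := by
        ext a b
        split_ifs with hj <;> simp [block, x, e, Matrix.diagonal_apply, Matrix.one_apply, hj]
      rw [this]
      split_ifs
      exacts [(D j).one_mem, (D j).zero_mem]
    · ext a b
      simp [block, x, e, hjk.ne']
  have hyb : ∀ i j k, k ≤ j → block d hA.sum_eq (y i) j k = 0 := by
    intro i j k hjk
    ext a b
    simp only [block, y, Matrix.submatrix_apply, Matrix.single_apply, Matrix.zero_apply]
    rw [if_neg]
    rintro ⟨h1, h2⟩
    have h1 : i.castSucc = j := congrArg Sigma.fst (e.injective h1)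
    have h2 : i.succ = k := congrArg Sigma.fst (e.injective h2)
    exact absurd hjk (not_le.mpr (h1 ▸ h2 ▸ i.castSucc_lt_succ))
  have hy : ∀ i, y i ∈ A := by
    intro i
    rw [hA.mem_iff]
    refine ⟨fun j => ?_, fun j k hjk => hyb i j k hjk.le⟩
    rw [hyb i j j le_rfl]
    exact (D j).zero_mem
  have hxy : ∀ i, x i * y i - y i * x i = y i := by
    intro i
    ext a b
    simp only [x, y, Matrix.sub_apply, Matrix.diagonal_mul, Matrix.mul_diagonal,
      Matrix.single_apply]
    by_cases hab : v i.castSucc = a ∧ v i.succ = b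
    · obtain ⟨rfl, rfl⟩ := hab
      have h1 : ¬ i.succ ≤ i.castSucc := not_le.mpr i.castSucc_lt_succ
      simp [v, h1]
    · simp [hab]
  have h1 := hS x y hx hy
  simp only [hxy] at h1
  have h2 := prod_single_apply (K := K) v
  rw [show (List.ofFn fun i : Fin p => Matrix.single (v i.castSucc) (v i.succ) (1 : K)).prod = 0
    from h1] at h2
  simp at h2

lemma IsOfType.isDqSubalgebra (hA : IsOfType d D A) (hD : ∀ i, IsCommSubalgebra (D i)) :
    IsDqSubalgebra q A := by
  refine ⟨hA.satisfiesDq hD, ?_⟩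
  obtain ⟨p, rfl⟩ : ∃ p, q = p + 1 := ⟨q - 1, by have := hA.two_le; omega⟩
  exact hA.not_satisfiesDq

lemma two_mul_sum_lt_add_sum_sq (d : Fin q → ℕ) :
    2 * ∑ p : {p : Fin q × Fin q // p.1 < p.2}, d p.1.1 * d p.1.2 + ∑ i, d i ^ 2 =
      (∑ i, d i) ^ 2 := by
  have h1 : ∑ p : {p : Fin q × Fin q // p.1 < p.2}, d p.1.1 * d p.1.2 =
      ∑ i, ∑ j, if i < j then d i * d j else 0 := by
    rw [← Finset.sum_product', ← Finset.sum_filter]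
    exact (Finset.sum_subtype _ (by simp) fun p : Fin q × Fin q => d p.1 * d p.2).symm
  have h2 : ∑ i, ∑ j, (if i < j then d i * d j else 0) =
      ∑ i, ∑ j, if j < i then d i * d j else 0 := by
    rw [Finset.sum_comm]
    simp only [mul_comm]
  have h3 : ∑ i, d i ^ 2 = ∑ i, ∑ j, if i = j then d i * d j else 0 := by
    simp [sq]
  rw [h1, two_mul]
  nth_rw 2 [h2]
  rw [h3, sq, Finset.sum_mul_sum, ← Finset.sum_add_distrib, ← Finset.sum_add_distrib]
  refine Finset.sum_congr rfl fun i _ => ?_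
  rw [← Finset.sum_add_distrib, ← Finset.sum_add_distrib]
  refine Finset.sum_congr rfl fun j _ => ?_
  rcases lt_trichotomy i j with hij | rfl | hij
  · simp [hij, hij.not_gt, hij.ne]
  · simp
  · simp [hij, hij.not_gt, hij.ne']

/-- The dimension of a block triangular subalgebra. -/
theorem IsOfType.finrank_eq (hA : IsOfType d D A) :
    finrank K A = ∑ i, finrank K (D i) +
      ∑ p : {p : Fin q × Fin q // p.1 < p.2}, d p.1.1 * d p.1.2 := by
  let φ : A →ₗ[K] ((∀ i, D i) × (∀ p : {p : Fin q × Fin q // p.1 < p.2},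
      Matrix (Fin (d p.1.1)) (Fin (d p.1.2)) K)) :=
    { toFun := fun M => (fun i => ⟨block d hA.sum_eq M.1 i i, ((hA.mem_iff M.1).mp M.2).1 i⟩,
        fun p => block d hA.sum_eq M.1 p.1.1 p.1.2)
      map_add' := fun _ _ => rfl
      map_smul' := fun _ _ => rfl }
  have hφ : Function.Bijective φ := by
    constructor
    · intro M N hMN
      refine Subtype.ext (block_ext hA.sum_eq fun i j => ?_)
      rcases lt_trichotomy i j with hij | rfl | hij
      · exact congrFun (congrArg Prod.snd hMN) ⟨(i, j), hij⟩
      · exact congrArg Subtype.val (congrFun (congrArg Prod.fst hMN) i)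
      · rw [((hA.mem_iff M.1).mp M.2).2 i j hij, ((hA.mem_iff N.1).mp N.2).2 i j hij]
    · rintro ⟨f, g⟩
      let F : ∀ i j : Fin q, Matrix (Fin (d i)) (Fin (d j)) K := fun i j =>
        if hij : i < j then g ⟨(i, j), hij⟩
        else if hij' : i = j then hij' ▸ (f i).1 else 0
      have hFd : ∀ i, F i i = (f i).1 := fun i => by simp [F]
      have hFu : ∀ p : {p : Fin q × Fin q // p.1 < p.2}, F p.1.1 p.1.2 = g p := fun p => by
        simp [F, p.2]
      have hFl : ∀ i j, j < i → F i j = 0 := fun i j hij => by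
        simp [F, hij.not_gt, hij.ne']
      have hmem : ofBlocks hA.sum_eq F ∈ A := by
        rw [hA.mem_iff]
        refine ⟨fun i => ?_, fun i j hij => ?_⟩
        · rw [block_ofBlocks, hFd]
          exact (f i).2
        · rw [block_ofBlocks, hFl i j hij]
      refine ⟨⟨_, hmem⟩, Prod.ext (funext fun i => Subtype.ext ?_) (funext fun p => ?_)⟩
      · exact (block_ofBlocks _ _ _ _).trans (hFd i)
      · exact (block_ofBlocks _ _ _ _).trans (hFu p)
  have h := (LinearEquiv.ofBijective φ hφ).finrank_eq
  have (i : Fin q) := Module.Free.of_divisionRing K (D i)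
  rw [h, Module.finrank_prod, Module.finrank_pi_fintype, Module.finrank_pi_fintype]
  simp [Module.finrank_matrix]

/-- The dimension of a block triangular subalgebra with max-dim diagonal blocks. -/
theorem IsOfType.two_mul_finrank_add (hA : IsOfType d D A)
    (hD : ∀ i, HasMaxDim IsCommSubalgebra (D i)) :
    2 * finrank K A + ∑ i, d i ^ 2 = n ^ 2 + 2 * ∑ i, (d i ^ 2 / 4 + 1) := by
  have h := two_mul_sum_lt_add_sum_sq d
  rw [hA.sum_eq] at h
  rw [hA.finrank_eq, ← h, Finset.sum_congr rfl fun i _ => (hD i).finrank_comm_eq (hA.pos i)]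
  ring

end IsOfType

/-! ### Equality in the bound -/

section Maximum

variable {K : Type*} [Field K] {n q : ℕ} {d : Fin q → ℕ}
  {D : (i : Fin q) → Subalgebra K (Matrix (Fin (d i)) (Fin (d i)) K)}
  {A : Subalgebra K (Matrix (Fin n) (Fin n) K)}

/-- The bound of `SatisfiesDq.two_mul_finrank_matrix_le` is attained by the block triangular
subalgebras with max-dim diagonal blocks whose block sizes are all in `{2k, 2k + 1, 2k + 2}`, and
only by those. -/
lemma IsOfType.two_mul_finrank_eq_iff (hA : IsOfType d D A)
    (hD : ∀ i, HasMaxDim IsCommSubalgebra (D i)) (k : ℕ) :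
    2 * (finrank K A : ℤ) + (2 * k + 1) * n = (n : ℤ) ^ 2 + 2 * q + 2 * q * k * (k + 1) ↔
      ∀ i, d i = 2 * k ∨ d i = 2 * k + 1 ∨ d i = 2 * k + 2 := by
  have h1 := hA.two_mul_finrank_add hD
  have h2 := hA.sum_eq
  rw [Finset.sum_add_distrib] at h1
  simp only [Finset.sum_const, Finset.card_univ, Fintype.card_fin, smul_eq_mul, mul_one] at h1
  zify at h1 h2
  -- A sum of inequalities is an equality only if every term is, which forces each block size to be
  -- a point of tangency.
  have h3 := Finset.sum_eq_sum_iff_of_le (s := Finset.univ) fun i _ => tangent_le (d i) k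
  simp only [Finset.sum_add_distrib, ← Finset.mul_sum, tangent_eq_iff, Finset.sum_const,
    Finset.card_univ, Fintype.card_fin, nsmul_eq_mul, Finset.mem_univ, forall_true_left, h2] at h3
  rw [← h3]
  push_cast
  constructor <;> intro h <;> linarith

/-- The witness has balanced sizes ⌊n/q⌋ and ⌊n/q⌋ + 1, which lie in {2k, 2k + 1, 2k + 2} for k =
⌊⌊n/q⌋/2⌋ whatever the parity of ⌊n/q⌋. -/
lemma exists_isOfType_two_mul_finrank_eq (hq : 2 ≤ q) (hn : q ≤ n) :
    ∃ B : Subalgebra K (Matrix (Fin n) (Fin n) K), IsDqSubalgebra q B ∧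
      2 * (finrank K B : ℤ) + (2 * (n / q / 2 : ℕ) + 1) * n =
        (n : ℤ) ^ 2 + 2 * q + 2 * q * (n / q / 2 : ℕ) * ((n / q / 2 : ℕ) + 1) := by
  have hm : 0 < n / q := Nat.div_pos hn (by omega)
  let d : Fin q → ℕ := fun i => if (i : ℕ) < n % q then n / q + 1 else n / q
  have hd : ∀ i, 0 < d i := fun i => by
    simp only [d]
    split_ifs <;> omega
  have hsum : ∑ i, d i = n := by
    have h1 : ∀ i, d i = n / q + if (i : ℕ) < n % q then 1 else 0 := fun i => by
      simp only [d]
      split_ifs <;> rfl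
    have h2 : (Finset.univ.filter fun i : Fin q => (i : ℕ) < n % q).card = n % q := by
      rw [Fin.card_filter_val_lt, min_eq_right (Nat.mod_lt n (by omega)).le]
    rw [Finset.sum_congr rfl fun i _ => h1 i, Finset.sum_add_distrib, ← Finset.card_filter, h2]
    simp [Nat.div_add_mod]
  have hC (i : Fin q) := exists_comm_finrank_eq (K := K) (hd i)
  choose C hC hCd using hC
  have hmax : ∀ i, HasMaxDim IsCommSubalgebra (C i) := fun i =>
    ⟨hC i, fun B hB => (hCd i).symm ▸ finrank_comm_matrix_le B hB⟩
  have hT := isOfType_blockTriangularSubalgebra hsum hq hd C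
  refine ⟨_, hT.isDqSubalgebra hC, (hT.two_mul_finrank_eq_iff hmax _).mpr fun i => ?_⟩
  simp only [d]
  split_ifs <;> omega

lemma IsOfType.card_le (hA : IsOfType d D A) : q ≤ n := by
  have h := Finset.sum_le_sum fun i (_ : i ∈ Finset.univ) => Nat.succ_le_of_lt (hA.pos i)
  rw [hA.sum_eq] at h
  simpa using h

/-- A block triangular subalgebra with max-dim diagonal blocks has maximum dimension among the
`D_q` subalgebras if and only if its block sizes are all in `{2k, 2k + 1, 2k + 2}`, where
`k = ⌊⌊n / q⌋ / 2⌋`. -/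
theorem IsOfType.hasMaxDim_iff (hA : IsOfType d D A)
    (hD : ∀ i, HasMaxDim IsCommSubalgebra (D i)) :
    HasMaxDim (IsDqSubalgebra q) A ↔
      ∀ i, d i = 2 * (n / q / 2) ∨ d i = 2 * (n / q / 2) + 1 ∨ d i = 2 * (n / q / 2) + 2 := by
  rw [← hA.two_mul_finrank_eq_iff hD]
  have hDq := hA.isDqSubalgebra fun i => (hD i).1
  constructor
  · rintro ⟨-, hmax⟩
    obtain ⟨B, hB, hBd⟩ := exists_isOfType_two_mul_finrank_eq (K := K) hA.two_le hA.card_le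
    refine le_antisymm (hDq.1.two_mul_finrank_matrix_le _ q n A) ?_
    have := hmax B hB
    rw [← hBd]
    gcongr
  · refine fun h => ⟨hDq, fun B hB => ?_⟩
    have := hB.1.two_mul_finrank_matrix_le (n / q / 2) q n B
    rw [← h] at this
    omega

end Maximum

/-! ### From the three allowed sizes to the explicit sorted lists -/

section Sorting

/-- In a sorted sequence the terms at most c form an initial segment, so it is determined by these
counts; the + 1 passes from indices starting at 0 to positions starting at 1. -/
lemma le_iff_succ_le_card {q : ℕ} {e : Fin q → ℕ} (he : Monotone e) (c : ℕ) (i : Fin q) :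
    e i ≤ c ↔ (i : ℕ) + 1 ≤ (Finset.univ.filter fun j => e j ≤ c).card := by
  constructor
  · intro h
    rw [← Fin.card_Iic i]
    exact Finset.card_le_card fun j hj => by
      simpa using (he (Finset.mem_Iic.mp hj)).trans h
  · intro h
    by_contra! hlt
    have h1 : (Finset.univ.filter fun j => e j ≤ c) ⊆ Finset.Iio i := fun j hj => by
      rw [Finset.mem_Iio]
      by_contra! hij
      exact absurd (he hij) (not_le.mpr ((Finset.mem_filter.mp hj).2.trans_lt hlt))
    have h2 := Finset.card_le_card h1
    rw [Fin.card_Iio] at h2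
    omega

/-- Each term falls short of 2k + 2 by the number of thresholds 2k, 2k + 1 that it does not exceed.
-/
lemma sum_add_card_add_card {q k : ℕ} {e : Fin q → ℕ}
    (he : ∀ i, e i = 2 * k ∨ e i = 2 * k + 1 ∨ e i = 2 * k + 2) :
    ∑ i, e i + (Finset.univ.filter fun j => e j ≤ 2 * k).card +
      (Finset.univ.filter fun j => e j ≤ 2 * k + 1).card = q * (2 * k + 2) := by
  rw [Finset.card_filter, Finset.card_filter, ← Finset.sum_add_distrib, ← Finset.sum_add_distrib]
  have h : ∀ i ∈ Finset.univ, (e i + (if e i ≤ 2 * k then 1 else 0) +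
      if e i ≤ 2 * k + 1 then 1 else 0) = 2 * k + 2 := fun i _ => by
    rcases he i with h | h | h <;> simp [h]
  rw [Finset.sum_congr rfl h]
  simp

/-- The explicit description of the sequences of given sum with all the terms in
`{2k, 2k + 1, 2k + 2}`. -/
lemma forall_mem_iff_exists_perm {n q r : ℕ} {d : Fin q → ℕ}
    (hsum : ∑ i, d i = n) (hr : r < q) (hn : n = q * (n / q) + r) :
    (∀ i, d i = 2 * (n / q / 2) ∨ d i = 2 * (n / q / 2) + 1 ∨ d i = 2 * (n / q / 2) + 2) ↔
      ∃ σ : Equiv.Perm (Fin q), (∀ i j : Fin q, i < j → d (σ i) ≤ d (σ j)) ∧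
        ((Even (n / q) ∧ ∃ s : ℕ, s ≤ r / 2 ∧ ∀ i : Fin q,
            d (σ i) =
              if (i : ℕ) + 1 ≤ q - r + s then n / q
              else if (i : ℕ) + 1 ≤ q - s then n / q + 1
              else n / q + 2) ∨
         (Odd (n / q) ∧ ∃ t : ℕ, t ≤ (q - r) / 2 ∧ ∀ i : Fin q,
            d (σ i) =
              if (i : ℕ) + 1 ≤ t then n / q - 1
              else if (i : ℕ) + 1 ≤ q - r - t then n / q
              else n / q + 1)) := by
  constructor
  · intro h
    have hmono : Monotone (d ∘ Tuple.sort d) := Tuple.monotone_sort d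
    refine ⟨Tuple.sort d, fun i j hij => hmono hij.le, ?_⟩
    have he : ∀ i, (d ∘ Tuple.sort d) i = 2 * (n / q / 2) ∨
        (d ∘ Tuple.sort d) i = 2 * (n / q / 2) + 1 ∨
        (d ∘ Tuple.sort d) i = 2 * (n / q / 2) + 2 := fun i => h _
    have hcard := sum_add_card_add_card he
    have hle := le_iff_succ_le_card hmono
    have hes : ∑ i, (d ∘ Tuple.sort d) i = n := by
      rw [← hsum]
      exact Equiv.sum_comp (Tuple.sort d) d
    rw [hes] at hcard
    change _ ∨ _
    have ha := hle (2 * (n / q / 2))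
    have hb := hle (2 * (n / q / 2) + 1)
    have hab : (Finset.univ.filter fun j => (d ∘ Tuple.sort d) j ≤ 2 * (n / q / 2)).card ≤
        (Finset.univ.filter fun j => (d ∘ Tuple.sort d) j ≤ 2 * (n / q / 2) + 1).card :=
      Finset.card_le_card fun j hj => by
        simp only [Finset.mem_filter, Finset.mem_univ, true_and] at hj ⊢
        omega
    have hbq : (Finset.univ.filter fun j => (d ∘ Tuple.sort d) j ≤ 2 * (n / q / 2) + 1).card ≤
        q := (Finset.card_le_univ _).trans (Fintype.card_fin q).le
    simp only [Function.comp_apply] at *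
    generalize (Finset.univ.filter fun j => d (Tuple.sort d j) ≤ 2 * (n / q / 2)).card = a at *
    generalize (Finset.univ.filter fun j => d (Tuple.sort d j) ≤ 2 * (n / q / 2) + 1).card = b at *
    generalize n / q = m at *
    clear hle hmono hes h
    rcases Nat.even_or_odd' m with ⟨k, rfl | rfl⟩
    · refine Or.inl ⟨even_two_mul k, ?_⟩
      have hk : 2 * k / 2 = k := by omega
      simp only [hk] at he ha hb hcard
      have h1 : a + b + r = 2 * q := by
        rw [hn] at hcard
        linarith
      -- s counts the terms equal to 2k + 2. From a + b + r = 2q the first breakpoint a is q - r +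
      -- s, and a ≤ b becomes s ≤ r/2.
      refine ⟨q - b, by omega, fun i => ?_⟩
      have := he i
      have := ha i
      have := hb i
      split_ifs <;> omega
    · refine Or.inr ⟨odd_two_mul_add_one k, ?_⟩
      have hk : (2 * k + 1) / 2 = k := by omega
      simp only [hk] at he ha hb hcard
      have h1 : a + b + r = q := by
        rw [hn] at hcard
        linarith
      -- t counts the terms equal to 2k = ⌊n/q⌋ - 1. From a + b + r = q the second breakpoint b is q
      -- - r - t, and a ≤ b becomes t ≤ (q - r)/2.
      refine ⟨a, by omega, fun i => ?_⟩
      have := he i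
      have := ha i
      have := hb i
      split_ifs <;> omega
  -- Only the three possible values matter here, not where the breakpoints fall.
  · rintro ⟨σ, -, ⟨⟨k, hk⟩, s, -, h⟩ | ⟨⟨k, hk⟩, t, -, h⟩⟩ i <;>
    · have h1 := h (σ.symm i)
      rw [Equiv.apply_symm_apply] at h1
      split_ifs at h1 <;> omega

end Sorting

end DqAlg

theorem mainTheorem12 {K : Type*} [Field K] {n q : ℕ} (d : Fin q → ℕ)
    (A : Subalgebra K (Matrix (Fin n) (Fin n) K))
    (hA : DqAlg.IsOfTypeWithMaxDimBlocks d A)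
    (r : ℕ) (hr : r < q) (hn : n = q * (n / q) + r) :
    DqAlg.HasMaxDim (DqAlg.IsDqSubalgebra q) A ↔
      ∃ σ : Equiv.Perm (Fin q), (∀ i j : Fin q, i < j → d (σ i) ≤ d (σ j)) ∧
        ((Even (n / q) ∧ ∃ s : ℕ, s ≤ r / 2 ∧ ∀ i : Fin q,
            d (σ i) =
              if (i : ℕ) + 1 ≤ q - r + s then n / q
              else if (i : ℕ) + 1 ≤ q - s then n / q + 1
              else n / q + 2) ∨
         (Odd (n / q) ∧ ∃ t : ℕ, t ≤ (q - r) / 2 ∧ ∀ i : Fin q,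
            d (σ i) =
              if (i : ℕ) + 1 ≤ t then n / q - 1
              else if (i : ℕ) + 1 ≤ q - r - t then n / q
              else n / q + 1)) := by
  obtain ⟨D, hT, hD⟩ := hA
  rw [hT.hasMaxDim_iff hD]
  exact DqAlg.forall_mem_iff_exists_perm hT.sum_eq hr hn
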